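/- We work in many-sorted first-order logic with equality. A signature $\Sigma$ consists of a nonempty set $\mathcal{S}_\Sigma$ of sorts, a set of function symbols and a set of predicate symbols, each with an arity over the sorts, together with an equality symbol for every sort; there are countably infinitely many variables of each sort. $\Sigma$ is countable if it has countably many sorts, function symbols and predicate symbols. A $\Sigma$-theory $\mathcal{T}$ is a set of $\Sigma$-sentences. A $\Sigma$-interpretation $\mathcal{A}$ is a $\Sigma$-structure, in which every sort $\sigma$ is interpreted as a nonempty set $\sigma^{\mathcal{A}}$ and equality as the identity, together with an assignment of values to the variables; it is a $\mathcal{T}$-interpretation if it satisfies all sentences of $\mathcal{T}$. Let $S \subseteq \mathcal{S}_\Sigma$ be any set of sorts (finite or infinite). - $\mathcal{T}$ is *stably finite* with respect to $S$ if for every quantifier-free formula $\varphi$ and every $\mathcal{T}$-interpretation $\mathcal{A}$ satisfying $\varphi$, there is a $\mathcal{T}$-interpretation $\mathcal{B}$ satisfying $\varphi$ such that $|\sigma^{\mathcal{B}}| \le |\sigma^{\mathcal{A}}|$ and $|\sigma^{\mathcal{B}}| < \aleph_0$ for every $\sigma \in S$. - $\mathcal{T}$ is *finitely smooth* with respect to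 $S$ if for every quantifier-free formula $\varphi$, every $\mathcal{T}$-interpretation $\mathcal{A}$ satisfying $\varphi$, and every function $\kappa$ from $S_{<} = \{\sigma \in S : |\sigma^{\mathcal{A}}| < \aleph_0\}$ to the class of cardinals with $|\sigma^{\mathcal{A}}| \le \kappa(\sigma) < \aleph_0$ for every $\sigma \in S_{<}$, there is a $\mathcal{T}$-interpretation $\mathcal{B}$ satisfying $\varphi$ with $|\sigma^{\mathcal{B}}| = \kappa(\sigma)$ for every $\sigma \in S_{<}$. - $\mathcal{T}$ is *smooth* with respect to $S$ if for every quantifier-free formula $\varphi$, every $\mathcal{T}$-interpretation $\mathcal{A}$ satisfying $\varphi$, and every function $\kappa$ from $S$ to the class of cardinals with $\kappa(\sigma) \ge |\sigma^{\mathcal{A}}|$ for every $\sigma \in S$, there is a $\mathcal{T}$-interpretation $\mathcal{B}$ satisfying $\varphi$ with $|\sigma^{\mathcal{B}}| = \kappa(\sigma)$ for every $\sigma \in S$. **Theorem.** Let $\Sigma$ be a countable signature, $\mathcal{T}$ a $\Sigma$-theory and $S \subseteq \mathcal{S}_\Sigma$. If $\mathcal{T}$ is stably finite and finitely smooth, both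 with respect to $S$, then $\mathcal{T}$ is smooth with respect to $S$. -/

import Mathlib

universe u w

namespace ManySorted

/-- A many-sorted signature. The equality symbols `=_σ` (one for each sort) are always present
and are therefore built into the formulas instead of being listed among `Preds`. -/
structure Signature : Type (u + 1) where
  Sorts : Type u
  sorts_nonempty : Nonempty Sorts
  Funcs : Type u
  Preds : Type u
  funArity : Funcs → ℕ
  funDom : (f : Funcs) → Fin (funArity f) → Sorts
  funCod : Funcs → Sorts
  predArity : Preds → ℕ
  predDom : (P : Preds) → Fin (predArity P) → Sorts

/-- Countably many sorts, function symbols and predicate symbols. (The equality symbols are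
then countably many as well.) -/
def Signature.IsCountable (L : Signature.{u}) : Prop :=
  Countable L.Sorts ∧ Countable L.Funcs ∧ Countable L.Preds

/-- Variables: countably infinitely many of every sort; `(σ, n)` is the `n`-th one of sort `σ`. -/
abbrev Var (L : Signature.{u}) : Type u := L.Sorts × ℕ

/-- Terms, indexed by their sort. -/
inductive Term (L : Signature.{u}) : L.Sorts → Type u
  | var (x : Var L) : Term L x.1
  | app (f : L.Funcs) (ts : (i : Fin (L.funArity f)) → Term L (L.funDom f i)) :
      Term L (L.funCod f)

/-- First-order formulas over `L` with equality. The remaining connectives and the existential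
quantifier are the usual classical abbreviations. -/
inductive Formula (L : Signature.{u}) : Type u
  | falsum : Formula L
  | eq (σ : L.Sorts) (s t : Term L σ) : Formula L
  | rel (P : L.Preds) (ts : (i : Fin (L.predArity P)) → Term L (L.predDom P i)) : Formula L
  | imp (φ ψ : Formula L) : Formula L
  | all (x : Var L) (φ : Formula L) : Formula L

variable {L : Signature.{u}}

/-- The variables of a term. -/
def Term.vars : {σ : L.Sorts} → Term L σ → Set (Var L)
  | _, .var x => {x}
  | _, .app _ ts => ⋃ i, (ts i).vars

/-- The free variables of a formula. -/
def Formula.freeVars : Formula L → Set (Var L)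
  | .falsum => ∅
  | .eq _ s t => s.vars ∪ t.vars
  | .rel _ ts => ⋃ i, (ts i).vars
  | .imp φ ψ => φ.freeVars ∪ ψ.freeVars
  | .all x φ => φ.freeVars \ {x}

/-- Quantifier-free formulas. -/
def Formula.IsQF : Formula L → Prop
  | .falsum => True
  | .eq _ _ _ => True
  | .rel _ _ => True
  | .imp φ ψ => φ.IsQF ∧ ψ.IsQF
  | .all _ _ => False

/-- A sentence is a formula without free variables. -/
def Formula.IsSentence (φ : Formula L) : Prop := φ.freeVars = ∅

variable (L) in
/-- A theory is a set of sentences. -/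
abbrev Theory : Type u := Set {φ : Formula L // φ.IsSentence}

variable (L) in
/-- A structure interprets every sort as a nonempty set. -/
structure Struct : Type (max u (w + 1)) where
  carrier : L.Sorts → Type w
  carrier_nonempty : (σ : L.Sorts) → Nonempty (carrier σ)
  funMap : (f : L.Funcs) → ((i : Fin (L.funArity f)) → carrier (L.funDom f i)) →
    carrier (L.funCod f)
  predMap : (P : L.Preds) → ((i : Fin (L.predArity P)) → carrier (L.predDom P i)) → Prop

/-- An assignment maps every variable of sort `σ` to an element of the domain of `σ`. -/
abbrev Struct.Assignment (A : Struct.{u, w} L) : Type (max u w) :=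
  (x : Var L) → A.carrier x.1

/-- The value of a term in a structure under an assignment. -/
def Term.eval (A : Struct.{u, w} L) (ν : A.Assignment) :
    {σ : L.Sorts} → Term L σ → A.carrier σ
  | _, .var x => ν x
  | _, .app f ts => A.funMap f fun i => (ts i).eval A ν

open Classical in
/-- Satisfaction of a formula in a structure under an assignment; equality is interpreted as
the identity. -/
def Formula.Holds (A : Struct.{u, w} L) : Formula L → A.Assignment → Prop
  | .falsum, _ => False
  | .eq _ s t, ν => s.eval A ν = t.eval A ν
  | .rel P ts, ν => A.predMap P fun i => (ts i).eval A ν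
  | .imp φ ψ, ν => φ.Holds A ν → ψ.Holds A ν
  | .all x φ, ν => ∀ a : A.carrier x.1, φ.Holds A (Function.update ν x a)

variable (L) in
/-- An interpretation is a structure together with an assignment. -/
structure Interp : Type (max u (w + 1)) where
  struct : Struct.{u, w} L
  val : struct.Assignment

/-- `A.Sat φ` says that the interpretation `A` satisfies the formula `φ`. -/
def Interp.Sat (A : Interp.{u, w} L) (φ : Formula L) : Prop := φ.Holds A.struct A.val

/-- The cardinality of the domain of the sort `σ` in `A`. -/
def Interp.card (A : Interp.{u, w} L) (σ : L.Sorts) : Cardinal.{w} :=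
  Cardinal.mk (A.struct.carrier σ)

/-- `T.IsInterp A` says that `A` is a `T`-interpretation. -/
def Theory.IsInterp (T : Theory L) (A : Interp.{u, w} L) : Prop :=
  ∀ ψ : {φ : Formula L // φ.IsSentence}, ψ ∈ T → A.Sat ψ.1

/-- `T` is stably finite with respect to the set of sorts `S`. -/
def Theory.StablyFinite (T : Theory L) (S : Set L.Sorts) : Prop :=
  ∀ φ : Formula L, φ.IsQF → ∀ A : Interp.{u, w} L, T.IsInterp A → A.Sat φ →
    ∃ B : Interp.{u, w} L, T.IsInterp B ∧ B.Sat φ ∧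
      ∀ σ ∈ S, B.card σ ≤ A.card σ ∧ B.card σ < Cardinal.aleph0

/-- `T` is finitely smooth with respect to the set of sorts `S`: finite cardinalities can be
prescribed for those sorts of `S` whose domain in the given interpretation is finite. -/
def Theory.FinitelySmooth (T : Theory L) (S : Set L.Sorts) : Prop :=
  ∀ φ : Formula L, φ.IsQF → ∀ A : Interp.{u, w} L, T.IsInterp A → A.Sat φ →
    ∀ κ : ↥({σ | A.card σ < Cardinal.aleph0} ∩ S) → Cardinal.{w},
      (∀ σ, A.card σ.1 ≤ κ σ ∧ κ σ < Cardinal.aleph0) →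
      ∃ B : Interp.{u, w} L, T.IsInterp B ∧ B.Sat φ ∧ ∀ σ, B.card σ.1 = κ σ

/-- `T` is smooth with respect to the set of sorts `S`. -/
def Theory.Smooth (T : Theory L) (S : Set L.Sorts) : Prop :=
  ∀ φ : Formula L, φ.IsQF → ∀ A : Interp.{u, w} L, T.IsInterp A → A.Sat φ →
    ∀ κ : ↥S → Cardinal.{w}, (∀ σ, A.card σ.1 ≤ κ σ) →
      ∃ B : Interp.{u, w} L, T.IsInterp B ∧ B.Sat φ ∧ ∀ σ, B.card σ.1 = κ σ

end ManySorted

-- A model of the prescribed sizes is built as a Skolem hull of κ(σ) generators in every sort σ ∈ S,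
-- with an ultrafilter gluing together models whose sorts in S are finite. Stable finiteness
-- followed by finite smoothness supplies these: models of φ with exactly κ(σ) elements where κ(σ)
-- is finite, and as many as needed where it is infinite. In the hull (`exists_skolem_hull`)
-- distinct generators of the sorts in S stay distinct, and in sorts with finite κ(σ) they exhaust
-- the domain.
--
-- The danger is that an infinite sort σ becomes too large, because terms of sort σ may contain
-- generators of sorts with larger κ. The sorts are therefore ordered by κ, with ties broken
-- arbitrarily, and values of terms of sort σ are made invariant under order-preserving changes of
-- the generators of higher infinite sorts of S. Those generators can then be moved into fixed
-- countable sequences, so only κ(σ) terms matter (`mk_le_of_shift_invariant`); countability of the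
-- signature enters this count. For finitely many terms the invariance follows from Ramsey's theorem
-- (`exists_sizes`): sizes are chosen upwards along the order, each large compared with a number of
-- colours that depends only on the sizes of lower sorts.

universe v z

/-! ### Finite Ramsey theory -/

/-- **Finite Ramsey theorem** for `k`-element subsets of a finite linear order. -/
theorem exists_ramsey_bound (r k : ℕ) : ∀ n : ℕ, ∃ N : ℕ, ∀ {α : Type u} [LinearOrder α]
    {K : Type w} [Finite K], Nat.card K ≤ r → ∀ (X : Finset α), N ≤ X.card → ∀ f : Finset α → K,
      ∃ Y ⊆ X, Y.card = n ∧ ∃ col : K, ∀ A ⊆ Y, A.card = k → f A = col := by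
  induction k with
  | zero =>
    refine fun n => ⟨n, fun {α _ K _} _ X hX f => ?_⟩
    obtain ⟨Y, hY, hc⟩ := Finset.exists_subset_card_eq hX
    exact ⟨Y, hY, hc, f ∅, fun A _ hA => by rw [Finset.card_eq_zero.1 hA]⟩
  | succ k ih =>
    -- sets on which the colour of `insert y A` depends only on the minimum `y`
    have key : ∀ m : ℕ, ∃ M : ℕ, ∀ {α : Type u} [LinearOrder α] {K : Type w} [Finite K],
        Nat.card K ≤ r → ∀ (X : Finset α), M ≤ X.card → ∀ f : Finset α → K,
        ∃ Y ⊆ X, Y.card = m ∧ ∃ h : α → K, ∀ y ∈ Y, ∀ A ⊆ Y, A.card = k → (∀ a ∈ A, y < a) →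
          f (insert y A) = h y := by
      intro m
      induction m with
      | zero =>
        exact ⟨0, fun {α _ K _} _ X _ f => ⟨∅, by simp, rfl, fun _ => f ∅, by simp⟩⟩
      | succ m ihm =>
        obtain ⟨M, hM⟩ := ihm
        obtain ⟨N, hN⟩ := ih M
        refine ⟨N + 1, fun {α _ K _} hK X hX f => ?_⟩
        have hne : X.Nonempty := Finset.card_pos.1 (by omega)
        -- The minimum is set aside, and the rest is thinned out until the colour of `insert x A` no
        -- longer depends on `A`.
        set x := X.min' hne with hx
        have hxX : x ∈ X := X.min'_mem hne
        obtain ⟨Z, hZX, hZ, col, hcol⟩ := hN hK (X.erase x)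
          (by rw [Finset.card_erase_of_mem hxX]; omega) (fun A => f (insert x A))
        obtain ⟨Y, hYZ, hY, h, hh⟩ := hM hK Z hZ.ge f
        have hxlt : ∀ y ∈ Y, x < y := fun y hy =>
          Finset.min'_lt_of_mem_erase_min' X hne (hZX (hYZ hy))
        have hxY : x ∉ Y := fun h => lt_irrefl _ (hxlt x h)
        refine ⟨insert x Y, Finset.insert_subset hxX
          ((hYZ.trans hZX).trans (Finset.erase_subset _ _)),
          by rw [Finset.card_insert_of_notMem hxY, hY], Function.update h x col, ?_⟩
        intro y hy A hA hAk hlt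
        have hle : x ≤ y := by
          rcases Finset.mem_insert.1 hy with rfl | hy
          · exact le_rfl
          · exact (hxlt y hy).le
        have hAY : A ⊆ Y := fun a ha => by
          rcases Finset.mem_insert.1 (hA ha) with rfl | h
          · exact absurd (hlt _ ha) hle.not_gt
          · exact h
        rcases Finset.mem_insert.1 hy with rfl | hy
        · rw [Function.update_self]
          exact hcol A (hAY.trans hYZ) hAk
        · rw [Function.update_of_ne (hxlt y hy).ne']
          exact hh y hy A hAY hAk hlt
    intro n
    obtain ⟨M, hM⟩ := key (r * n + 1)
    refine ⟨M, fun {α _ K _} hK X hX f => ?_⟩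
    obtain ⟨Y, hYX, hY, h, hh⟩ := hM hK X hX f
    classical
    have := Fintype.ofFinite K
    rw [Nat.card_eq_fintype_card] at hK
    -- Pigeonhole: of `r * n + 1` possible minima, more than `n` share a colour.
    obtain ⟨col, -, hcol⟩ := Finset.exists_lt_card_fiber_of_mul_lt_card_of_maps_to
      (s := Y) (t := Finset.univ) (f := h) (n := n) (fun _ _ => Finset.mem_univ _) (by
        rw [hY, Finset.card_univ]
        exact Nat.lt_succ_of_le (Nat.mul_le_mul_right _ hK))
    obtain ⟨W, hW, hWn⟩ := Finset.exists_subset_card_eq hcol.le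
    refine ⟨W, (hW.trans (Finset.filter_subset _ _)).trans hYX, hWn, col, fun A hA hAk => ?_⟩
    have hne : A.Nonempty := Finset.card_pos.1 (by omega)
    have hmem := A.min'_mem hne
    rw [← Finset.insert_erase hmem, hh _ (Finset.mem_filter.1 (hW (hA hmem))).1]
    · exact (Finset.mem_filter.1 (hW (hA hmem))).2
    · exact ((Finset.erase_subset _ _).trans hA).trans (hW.trans (Finset.filter_subset _ _))
    · rw [Finset.card_erase_of_mem hmem, hAk]; rfl
    · exact fun a ha => Finset.min'_lt_of_mem_erase_min' A hne ha

/-- Finitely many colourings, of subsets of various sizes, have a common homogeneous set. -/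
theorem exists_ramsey_bound_family {ι : Type v} (Q : Finset ι) (k : ι → ℕ) (r n : ℕ) :
    ∃ N : ℕ, ∀ {α : Type u} [LinearOrder α] {K : ι → Type w},
      (∀ q ∈ Q, Finite (K q) ∧ Nat.card (K q) ≤ r) → ∀ (X : Finset α), N ≤ X.card →
      ∀ f : ∀ q, Finset α → K q,
      ∃ Y ⊆ X, Y.card = n ∧
        ∀ q ∈ Q, ∀ A ⊆ Y, ∀ B ⊆ Y, A.card = k q → B.card = k q → f q A = f q B := by
  classical
  induction Q using Finset.induction_on with
  | empty =>
    refine ⟨n, fun {α _ K} _ X hX f => ?_⟩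
    obtain ⟨Y, hY, hc⟩ := Finset.exists_subset_card_eq hX
    exact ⟨Y, hY, hc, by simp⟩
  | insert q Q _ ih =>
    obtain ⟨M, hM⟩ := ih
    obtain ⟨N, hN⟩ := exists_ramsey_bound.{u, w} r (k q) M
    refine ⟨N, fun {α _ K} hK X hX f => ?_⟩
    have := (hK q (Finset.mem_insert_self _ _)).1
    obtain ⟨Z, hZX, hZ, col, hcol⟩ := hN (hK q (Finset.mem_insert_self _ _)).2 X hX (f q)
    obtain ⟨Y, hYZ, hY, hh⟩ :=
      hM (fun p hp => hK p (Finset.mem_insert_of_mem hp)) Z hZ.ge f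
    refine ⟨Y, hYZ.trans hZX, hY, fun p hp A hA B hB hAk hBk => ?_⟩
    rcases Finset.mem_insert.1 hp with rfl | hp
    · rw [hcol A (hA.trans hYZ) hAk, hcol B (hB.trans hYZ) hBk]
    · exact hh p hp A hA B hB hAk hBk

/-- Strictly monotone functions on a finite set are determined by their image. -/
theorem Finset.eqOn_of_strictMonoOn_of_image_eq {α β : Type*} [LinearOrder α] [LinearOrder β]
    {s : Finset α} {f g : α → β} (hf : StrictMonoOn f s) (hg : StrictMonoOn g s)
    (h : s.image f = s.image g) : Set.EqOn f g s := by
  have hf' : StrictMono fun x : s => f x := fun x y hxy => hf x.2 y.2 hxy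
  have hg' : StrictMono fun x : s => g x := fun x y hxy => hg x.2 y.2 hxy
  have := (hf'.range_inj hg').1 (by
    ext b
    have := Finset.ext_iff.1 h b
    simpa using this)
  exact fun x hx => congrFun this ⟨x, hx⟩

/-- If `X` is large, then the set `D` can be embedded into `X` in such a way that the values of
finitely many finitary functions with few values are invariant under given shifts. -/
theorem exists_shift_invariant {C : Type v} [LinearOrder C] {ι : Type u} (Q : Finset ι)
    (s : ι → Finset C) (g : ι → C → C) (hg : ∀ q ∈ Q, StrictMonoOn (g q) (s q))
    (D : Finset C) (r : ℕ) :
    ∃ N : ℕ, ∀ {X : Type w} [Finite X], N ≤ Nat.card X → ∀ {K : ι → Type z},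
      (∀ q ∈ Q, Finite (K q) ∧ Nat.card (K q) ≤ r) → ∀ f : ∀ q, (C → X) → K q,
      (∀ q ∈ Q, ∀ e e' : C → X, (∀ c ∈ s q, e c = e' c) → f q e = f q e') →
      ∃ e : C → X, Set.InjOn e D ∧ ∀ q ∈ Q, f q (fun c => e (g q c)) = f q e := by
  classical
  set E : Finset C := D ∪ Q.biUnion (fun q => s q ∪ (s q).image (g q)) with hE
  have hsE : ∀ q ∈ Q, s q ⊆ E := fun q hq c hc =>
    Finset.mem_union_right _ (Finset.mem_biUnion.2 ⟨q, hq, Finset.mem_union_left _ hc⟩)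
  have hgE : ∀ q ∈ Q, ∀ c ∈ s q, g q c ∈ E := fun q hq c hc =>
    Finset.mem_union_right _ (Finset.mem_biUnion.2
      ⟨q, hq, Finset.mem_union_right _ (Finset.mem_image_of_mem _ hc)⟩)
  obtain ⟨N, hN⟩ := exists_ramsey_bound_family.{w, z, u} Q (fun q => (s q).card) r E.card
  refine ⟨N + 1, fun {X _} hX {K} hK f hf => ?_⟩
  have : Nonempty X := (Nat.card_pos_iff.1 (by omega)).1
  obtain ⟨x₀⟩ := this
  have := Fintype.ofFinite X
  let _ : LinearOrder X := LinearOrder.lift' (Finite.equivFin X) (Finite.equivFin X).injective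
  -- A subset of `X` of the size of `s q` is the image of `s q` under an increasing map, unique on
  -- `s q`, and gets the value of `f q` there; the other branch is a dummy.
  let col : ∀ q, Finset X → K q := fun q A =>
    if h : ∃ h : C → X, StrictMonoOn h (s q) ∧ (s q).image h = A then f q h.choose
    else f q fun _ => x₀
  have hcol : ∀ q ∈ Q, ∀ h : C → X, StrictMonoOn h (s q) → col q ((s q).image h) = f q h := by
    intro q hq h hh
    have hex : ∃ h' : C → X, StrictMonoOn h' (s q) ∧ (s q).image h' = (s q).image h :=
      ⟨h, hh, rfl⟩
    simp only [col, dif_pos hex]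
    exact hf q hq _ _ (Finset.eqOn_of_strictMonoOn_of_image_eq hex.choose_spec.1 hh
      hex.choose_spec.2)
  obtain ⟨Y, -, hY, hhom⟩ := hN hK Finset.univ
    (by rw [Finset.card_univ, ← Nat.card_eq_fintype_card]; omega) col
  let e : C → X := fun c => if h : c ∈ E then
    Y.orderEmbOfFin hY ((E.orderIsoOfFin rfl).symm ⟨c, h⟩) else x₀
  have heY : ∀ c ∈ E, e c ∈ Y := fun c hc => by
    simp only [e, dif_pos hc]; exact Y.orderEmbOfFin_mem hY _
  have he : StrictMonoOn e E := fun c hc d hd hcd => by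
    simp only [e, dif_pos (Finset.mem_coe.1 hc), dif_pos (Finset.mem_coe.1 hd)]
    exact (Y.orderEmbOfFin hY).strictMono ((E.orderIsoOfFin rfl).symm.strictMono hcd)
  refine ⟨e, he.injOn.mono (fun c hc => Finset.mem_union_left _ hc), fun q hq => ?_⟩
  have h1 : StrictMonoOn e (s q) := he.mono (hsE q hq)
  have h2 : StrictMonoOn (fun c => e (g q c)) (s q) := fun c hc d hd hcd =>
    he (hgE q hq c hc) (hgE q hq d hd) (hg q hq hc hd hcd)
  -- Both maps are increasing on `s q` with images in the homogeneous set `Y`, so their colours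
  -- agree.
  rw [← hcol q hq _ h1, ← hcol q hq _ h2]
  refine hhom q hq _ ?_ _ ?_ (Finset.card_image_of_injOn h2.injOn)
    (Finset.card_image_of_injOn h1.injOn)
  · exact Finset.image_subset_iff.2 fun c hc => heY _ (hgE q hq c hc)
  · exact Finset.image_subset_iff.2 fun c hc => heY _ (hsE q hq hc)

/-! ### Terms over generators, and counting of terms and formulas -/

namespace ManySorted

/-- Terms over the function symbols of `L`, built from the elements of a family `C`. -/
inductive HTerm (L : Signature.{u}) (C : L.Sorts → Type w) : L.Sorts → Type (max u w)
  | const {σ : L.Sorts} (c : C σ) : HTerm L C σ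
  | app (f : L.Funcs) (ts : (i : Fin (L.funArity f)) → HTerm L C (L.funDom f i)) :
      HTerm L C (L.funCod f)

namespace HTerm

variable {L : Signature.{u}} {C : L.Sorts → Type w} {D : L.Sorts → Type v}

/-- The value of a term in a structure in which the generators are interpreted by `e`. -/
def eval (A : Struct.{u, z} L) (e : (σ : L.Sorts) → C σ → A.carrier σ) :
    {σ : L.Sorts} → HTerm L C σ → A.carrier σ
  | σ, .const c => e σ c
  | _, .app f ts => A.funMap f fun i => (ts i).eval A e

/-- Replacement of the generators. -/
def map (g : (σ : L.Sorts) → C σ → D σ) : {σ : L.Sorts} → HTerm L C σ → HTerm L D σ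
  | σ, .const c => .const (g σ c)
  | _, .app f ts => .app f fun i => (ts i).map g

/-- The generators that occur in a term. -/
def consts : {σ : L.Sorts} → HTerm L C σ → Set (Σ σ, C σ)
  | σ, .const c => {⟨σ, c⟩}
  | _, .app _ ts => ⋃ i, (ts i).consts

theorem finite_consts {σ : L.Sorts} (t : HTerm L C σ) : t.consts.Finite := by
  induction t with
  | const c => exact Set.finite_singleton _
  | app f ts ih => exact Set.finite_iUnion ih

theorem eval_congr (A : Struct.{u, z} L) {e e' : (σ : L.Sorts) → C σ → A.carrier σ}
    {σ : L.Sorts} (t : HTerm L C σ) (h : ∀ p ∈ t.consts, e p.1 p.2 = e' p.1 p.2) :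
    t.eval A e = t.eval A e' := by
  induction t with
  | const c => exact h _ rfl
  | app f ts ih =>
    exact congrArg (A.funMap f) (funext fun i => ih i fun p hp => h p (Set.mem_iUnion.2 ⟨i, hp⟩))

theorem eval_map (A : Struct.{u, z} L) (g : (σ : L.Sorts) → C σ → D σ)
    (e : (σ : L.Sorts) → D σ → A.carrier σ) {σ : L.Sorts} (t : HTerm L C σ) :
    (t.map g).eval A e = t.eval A fun σ c => e σ (g σ c) := by
  induction t with
  | const c => rfl
  | app f ts ih => exact congrArg (A.funMap f) (funext fun i => ih i)

/-- The tree underlying a term. -/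
def toWType : {σ : L.Sorts} → HTerm L C σ →
    WType (α := (Σ σ, C σ) ⊕ L.Funcs) (Sum.elim (fun _ => Fin 0) fun f => Fin (L.funArity f))
  | σ, .const c => ⟨.inl ⟨σ, c⟩, Fin.elim0⟩
  | _, .app f ts => ⟨.inr f, fun i => (ts i).toWType⟩

theorem toWType_injective {σ : L.Sorts} (t : HTerm L C σ) {τ : L.Sorts} (t' : HTerm L C τ)
    (h : t.toWType = t'.toWType) : (⟨σ, t⟩ : Σ σ, HTerm L C σ) = ⟨τ, t'⟩ := by
  induction t generalizing τ with
  | const c =>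
    cases t' with
    | const c' =>
      cases (WType.mk.inj h).1
      rfl
    | app f ts => cases (WType.mk.inj h).1
  | app f ts ih =>
    cases t' with
    | const c' => cases (WType.mk.inj h).1
    | app f' ts' =>
      obtain ⟨h, hts⟩ := WType.mk.inj h
      cases h
      have h := eq_of_heq hts
      have : ts = ts' := funext fun i => by
        have := ih i (ts' i) (congrFun h i)
        simpa using this
      rw [this]

/-- Terms embed into finitely branching trees labelled by generators and countably many function
symbols. -/
theorem mk_le (L : Signature.{u}) [Countable L.Funcs] (C : L.Sorts → Type w) (σ : L.Sorts) :
    Cardinal.mk (HTerm L C σ) ≤ max (Cardinal.mk (Σ σ, C σ)) Cardinal.aleph0 := by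
  have h1 : Cardinal.mk (HTerm L C σ) ≤
      Cardinal.mk (WType (α := (Σ σ, C σ) ⊕ L.Funcs)
        (Sum.elim (fun _ => Fin 0) fun f => Fin (L.funArity f))) :=
    Cardinal.mk_le_of_injective (f := toWType) fun t t' h => by
      simpa using toWType_injective t t' h
  have : ∀ a : (Σ σ, C σ) ⊕ L.Funcs,
      Finite (Sum.elim (fun _ => Fin 0) (fun f => Fin (L.funArity f)) a : Type) := by
    rintro (a | a) <;> exact inferInstanceAs (Finite (Fin _))
  refine h1.trans (WType.cardinalMk_le_max_aleph0_of_finite'.trans ?_)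
  refine max_le ?_ (le_max_right _ _)
  rw [Cardinal.lift_id'.{0, max u w}, Cardinal.mk_sum]
  refine Cardinal.add_le_of_le (le_max_right _ _) ?_ ?_
  · exact (Cardinal.lift_id'.{u, max u w} _).le.trans (le_max_left _ _)
  · refine le_trans ?_ (le_max_right _ _)
    simp

end HTerm

/-- The tree underlying a term. -/
def Term.toWType {L : Signature.{u}} : {σ : L.Sorts} → Term L σ →
    WType (α := Var L ⊕ L.Funcs) (Sum.elim (fun _ => Fin 0) fun f => Fin (L.funArity f))
  | _, .var x => ⟨.inl x, Fin.elim0⟩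
  | _, .app f ts => ⟨.inr f, fun i => (ts i).toWType⟩

theorem Term.toWType_injective {L : Signature.{u}} {σ : L.Sorts} (t : Term L σ) {τ : L.Sorts}
    (t' : Term L τ) (h : t.toWType = t'.toWType) :
    (⟨σ, t⟩ : Σ σ, Term L σ) = ⟨τ, t'⟩ := by
  induction t generalizing τ with
  | var x =>
    cases t' with
    | var x' =>
      cases (WType.mk.inj h).1
      rfl
    | app f ts => cases (WType.mk.inj h).1
  | app f ts ih =>
    cases t' with
    | var x' => cases (WType.mk.inj h).1
    | app f' ts' =>
      obtain ⟨h, hts⟩ := WType.mk.inj h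
      cases h
      have h := eq_of_heq hts
      have : ts = ts' := funext fun i => by
        have := ih i (ts' i) (congrFun h i)
        simpa using this
      rw [this]

theorem countable_wType {α : Type u} [Countable α] (β : α → Type) [∀ a, Finite (β a)] :
    Countable (WType β) := by
  rw [← Cardinal.mk_le_aleph0_iff]
  refine WType.cardinalMk_le_max_aleph0_of_finite'.trans ?_
  simp

theorem Term.countable {L : Signature.{u}} (hL : L.IsCountable) (σ : L.Sorts) :
    Countable (Term L σ) := by
  have := hL.1
  have := hL.2.1
  have : ∀ a : Var L ⊕ L.Funcs,
      Finite (Sum.elim (fun _ => Fin 0) (fun f => Fin (L.funArity f)) a : Type) := by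
    rintro (a | a) <;> exact inferInstanceAs (Finite (Fin _))
  have := countable_wType (α := Var L ⊕ L.Funcs)
    (Sum.elim (fun _ => Fin 0) fun f => Fin (L.funArity f))
  refine Function.Injective.countable (f := fun t : Term L σ => t.toWType) fun t t' h => ?_
  simpa using Term.toWType_injective t t' h

/-- The number of immediate subformulas, for every outermost symbol of a formula. -/
def Formula.arity (L : Signature.{u}) : (Option (Σ σ, Term L σ × Term L σ) ⊕
    Σ P : L.Preds, (i : Fin (L.predArity P)) → Term L (L.predDom P i)) ⊕ Option (Var L) → Type
  | .inl _ => Fin 0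
  | .inr none => Fin 2
  | .inr (some _) => Fin 1

/-- The tree underlying a formula. -/
def Formula.toWType {L : Signature.{u}} : Formula L → WType (Formula.arity L)
  | .falsum => ⟨.inl (.inl none), Fin.elim0⟩
  | .eq σ s t => ⟨.inl (.inl (some ⟨σ, s, t⟩)), Fin.elim0⟩
  | .rel P ts => ⟨.inl (.inr ⟨P, ts⟩), Fin.elim0⟩
  | .imp φ ψ => ⟨.inr none, fun i : Fin 2 => if i = 0 then φ.toWType else ψ.toWType⟩
  | .all x φ => ⟨.inr (some x), fun _ => φ.toWType⟩

theorem Formula.toWType_injective {L : Signature.{u}} :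
    Function.Injective (Formula.toWType (L := L)) := by
  intro φ
  induction φ with
  | falsum =>
    intro ψ h
    cases ψ <;> obtain ⟨h, -⟩ := WType.mk.inj h <;> cases h
    rfl
  | eq σ s t =>
    intro ψ h
    cases ψ <;> obtain ⟨h, -⟩ := WType.mk.inj h <;> cases h
    rfl
  | rel P ts =>
    intro ψ h
    cases ψ <;> obtain ⟨h, -⟩ := WType.mk.inj h <;> cases h
    rfl
  | imp φ ψ ih1 ih2 =>
    intro χ h
    cases χ <;> obtain ⟨h, hf⟩ := WType.mk.inj h <;> cases h
    have hf := eq_of_heq hf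
    rw [ih1 (congrFun hf (0 : Fin 2)), ih2 (congrFun hf (1 : Fin 2))]
  | all x φ ih =>
    intro χ h
    cases χ <;> obtain ⟨h, hf⟩ := WType.mk.inj h <;> cases h
    rw [ih (congrFun (eq_of_heq hf) (0 : Fin 1))]

/-- Skolem functions are indexed by formulas, so this keeps the Skolem signature countable. -/
theorem Formula.countable {L : Signature.{u}} (hL : L.IsCountable) : Countable (Formula L) := by
  have := hL.1
  have := hL.2.2
  have := Term.countable hL
  have : ∀ a, Finite (Formula.arity L a) := by
    rintro (a | _ | a) <;> exact inferInstanceAs (Finite (Fin _))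
  have := countable_wType (Formula.arity L)
  exact Formula.toWType_injective.countable

theorem Term.finite_vars {L : Signature.{u}} {σ : L.Sorts} (t : Term L σ) : t.vars.Finite := by
  induction t with
  | var x => exact Set.finite_singleton _
  | app f ts ih => exact Set.finite_iUnion ih

theorem Formula.finite_freeVars {L : Signature.{u}} (φ : Formula L) : φ.freeVars.Finite := by
  induction φ with
  | falsum => exact Set.finite_empty
  | eq σ s t => exact s.finite_vars.union t.finite_vars
  | rel P ts => exact Set.finite_iUnion fun i => (ts i).finite_vars
  | imp φ ψ ih1 ih2 => exact ih1.union ih2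
  | all x φ ih => exact ih.sdiff

theorem Term.eval_congr {L : Signature.{u}} (A : Struct.{u, w} L) {ν ν' : A.Assignment}
    {σ : L.Sorts} (t : Term L σ) (h : ∀ x ∈ t.vars, ν x = ν' x) :
    t.eval A ν = t.eval A ν' := by
  induction t with
  | var x => exact h _ rfl
  | app f ts ih =>
    exact congrArg (A.funMap f) (funext fun i => ih i fun x hx => h x (Set.mem_iUnion.2 ⟨i, hx⟩))

theorem Formula.holds_congr {L : Signature.{u}} (A : Struct.{u, w} L) (φ : Formula L)
    {ν ν' : A.Assignment} (h : ∀ x ∈ φ.freeVars, ν x = ν' x) : φ.Holds A ν ↔ φ.Holds A ν' := by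
  classical
  induction φ generalizing ν ν' with
  | falsum => rfl
  | eq σ s t =>
    simp only [Holds]
    rw [s.eval_congr A fun x hx => h x (.inl hx), t.eval_congr A fun x hx => h x (.inr hx)]
  | rel P ts =>
    simp only [Holds]
    rw [funext fun i => (ts i).eval_congr A fun x hx => h x (Set.mem_iUnion.2 ⟨i, hx⟩)]
  | imp φ ψ ih1 ih2 =>
    exact imp_congr (ih1 fun x hx => h x (.inl hx)) (ih2 fun x hx => h x (.inr hx))
  | all x φ ih =>
    simp only [Holds]
    refine forall_congr' fun a => ih fun y hy => ?_
    by_cases hyx : y = x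
    · subst hyx; simp
    · rw [Function.update_of_ne hyx, Function.update_of_ne hyx]
      exact h y ⟨hy, hyx⟩

end ManySorted

/-! ### Skolem functions and Skolem hulls modulo an ultrafilter -/

namespace ManySorted

/-- The signature `L` expanded by a Skolem function of the variables in `l` for every formula
`∀ x, φ` and every list `l` of variables, and by a constant symbol for every variable. -/
def Signature.skolem (L : Signature.{u}) : Signature.{u} where
  Sorts := L.Sorts
  sorts_nonempty := L.sorts_nonempty
  Funcs := L.Funcs ⊕ (Formula L × Var L × List (Var L)) ⊕ Var L
  Preds := PEmpty
  funArity
    | .inl f => L.funArity f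
    | .inr (.inl p) => p.2.2.length
    | .inr (.inr _) => 0
  funDom
    | .inl f => L.funDom f
    | .inr (.inl p) => fun i => (p.2.2.get i).1
    | .inr (.inr _) => Fin.elim0
  funCod
    | .inl f => L.funCod f
    | .inr (.inl p) => p.2.1.1
    | .inr (.inr x) => x.1
  predArity := PEmpty.elim
  predDom := fun P => P.elim

theorem Signature.countable_skolem_funcs {L : Signature.{u}} (hL : L.IsCountable) :
    Countable L.skolem.Funcs := by
  have := hL.1
  have := hL.2.1
  have := Formula.countable hL
  exact inferInstanceAs (Countable (L.Funcs ⊕ (Formula L × Var L × List (Var L)) ⊕ Var L))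

variable {L : Signature.{u}}

open Classical in
/-- The assignment that maps the variables in the list `l` to the entries of `a` and the other
ones to their values under `ν`. -/
noncomputable def Struct.override (A : Struct.{u, w} L) (ν : A.Assignment) (l : List (Var L))
    (a : (i : Fin l.length) → A.carrier (l.get i).1) : A.Assignment := fun x =>
  if h : ∃ i, l.get i = x then h.choose_spec ▸ a h.choose else ν x

theorem Struct.override_eq (A : Struct.{u, w} L) (ν μ : A.Assignment) (l : List (Var L))
    {x : Var L} (hx : x ∈ l) : A.override ν l (fun i => μ (l.get i)) x = μ x := by
  have h : ∃ i, l.get i = x := List.mem_iff_get.1 hx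
  have key : ∀ (y : Var L) (hy : y = x), (hy ▸ μ y : A.carrier x.1) = μ x := by
    rintro y rfl
    rfl
  rw [Struct.override, dif_pos h]
  exact key _ h.choose_spec

open Classical in
/-- An element that does not satisfy `φ` when it is assigned to `x`, if there is one. -/
noncomputable def Struct.witness (A : Struct.{u, w} L) (φ : Formula L) (x : Var L)
    (ν : A.Assignment) : A.carrier x.1 :=
  if h : ∃ a, ¬ φ.Holds A (Function.update ν x a) then h.choose
  else (A.carrier_nonempty x.1).some

open Classical in
theorem Struct.holds_all_of_witness (A : Struct.{u, w} L) (φ : Formula L) (x : Var L)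
    (ν : A.Assignment) (h : φ.Holds A (Function.update ν x (A.witness φ x ν))) :
    (Formula.all x φ).Holds A ν := by
  by_contra hn
  have hex : ∃ a, ¬ φ.Holds A (Function.update ν x a) := not_forall.1 hn
  rw [Struct.witness, dif_pos hex] at h
  exact hex.choose_spec h

/-- The witnesses are chosen from the same predicate, hence equal. A Skolem function thus needs only
the free variables of `∀ x, φ` as arguments. -/
theorem Struct.witness_congr (A : Struct.{u, w} L) (φ : Formula L) (x : Var L)
    {ν ν' : A.Assignment} (h : ∀ y ∈ φ.freeVars \ {x}, ν y = ν' y) :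
    A.witness φ x ν = A.witness φ x ν' := by
  classical
  have : ∀ a, φ.Holds A (Function.update ν x a) ↔ φ.Holds A (Function.update ν' x a) := by
    refine fun a => φ.holds_congr A fun y hy => ?_
    by_cases hyx : y = x
    · subst hyx; simp
    · rw [Function.update_of_ne hyx, Function.update_of_ne hyx]
      exact h y ⟨hy, hyx⟩
  simp only [Struct.witness, this]

/-- The expansion of an interpretation by Skolem functions and the values of the variables. -/
noncomputable def Interp.skolem (A : Interp.{u, w} L) : Struct.{u, w} L.skolem where
  carrier := A.struct.carrier
  carrier_nonempty := A.struct.carrier_nonempty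
  funMap
    | .inl f => A.struct.funMap f
    | .inr (.inl p) => fun a => A.struct.witness p.1 p.2.1 (A.struct.override A.val p.2.2 a)
    | .inr (.inr x) => fun _ => A.val x
  predMap := fun P => P.elim

section Hull

variable {C : L.Sorts → Type v} {I : Type z} (U : Ultrafilter I) (B : I → Interp.{u, w} L)
  (e : (i : I) → (σ : L.Sorts) → C σ → (B i).struct.carrier σ)

/-- The value of a Skolem term in the `i`-th interpretation. -/
noncomputable def skolemValue (i : I) {σ : L.Sorts} (t : HTerm L.skolem C σ) :
    (B i).struct.carrier σ :=
  t.eval (B i).skolem (e i)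

variable {U B e} {H : Struct.{u, w} L} {q : (σ : L.Sorts) → HTerm L.skolem C σ → H.carrier σ}

/-- The term `s` is `t` with every variable `x` replaced by `ν x`. -/
theorem exists_term_eval
    (hfun : ∀ (f : L.Funcs) (ts : (i : Fin (L.funArity f)) → HTerm L.skolem C (L.funDom f i)),
      H.funMap f (fun i => q _ (ts i)) = q (L.funCod f) (.app (L := L.skolem) (.inl f) ts))
    (ν : (x : Var L) → HTerm L.skolem C x.1) {σ : L.Sorts} (t : Term L σ) :
    ∃ s : HTerm L.skolem C σ, t.eval H (fun x => q _ (ν x)) = q σ s ∧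
      ∀ i, skolemValue B e i s = t.eval (B i).struct fun x => skolemValue B e i (ν x) := by
  induction t with
  | var x => exact ⟨ν x, rfl, fun i => rfl⟩
  | app f ts ih =>
    choose s hs hs' using ih
    refine ⟨.app (L := L.skolem) (.inl f) s, ?_, fun i => ?_⟩
    · rw [← hfun]
      exact congrArg (H.funMap f) (funext hs)
    · exact congrArg ((B i).struct.funMap f) (funext fun j => hs' j i)

/-- **Łoś's theorem** for a structure of Skolem terms modulo an ultrafilter. -/
theorem holds_iff_eventually (hq : ∀ σ, Function.Surjective (q σ))
    (heq : ∀ σ t t', q σ t = q σ t' ↔ ∀ᶠ i in U, skolemValue B e i t = skolemValue B e i t')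
    (hfun : ∀ (f : L.Funcs) (ts : (i : Fin (L.funArity f)) → HTerm L.skolem C (L.funDom f i)),
      H.funMap f (fun i => q _ (ts i)) = q (L.funCod f) (.app (L := L.skolem) (.inl f) ts))
    (hpred : ∀ (P : L.Preds)
      (ts : (i : Fin (L.predArity P)) → HTerm L.skolem C (L.predDom P i)),
      H.predMap P (fun i => q _ (ts i)) ↔
        ∀ᶠ i in U, (B i).struct.predMap P fun j => skolemValue B e i (ts j))
    (φ : Formula L) (ν : (x : Var L) → HTerm L.skolem C x.1) :
    φ.Holds H (fun x => q _ (ν x)) ↔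
      ∀ᶠ i in U, φ.Holds (B i).struct fun x => skolemValue B e i (ν x) := by
  classical
  induction φ generalizing ν with
  | falsum => simp [Formula.Holds, U.neBot.ne]
  | eq σ s t =>
    obtain ⟨s', hs, hs'⟩ := exists_term_eval (B := B) (e := e) hfun ν s
    obtain ⟨t', ht, ht'⟩ := exists_term_eval (B := B) (e := e) hfun ν t
    simp only [Formula.Holds, hs, ht, heq, hs', ht']
  | rel P ts =>
    choose s hs hs' using fun i => exists_term_eval (B := B) (e := e) hfun ν (ts i)
    simp only [Formula.Holds, hs, hpred, hs']
  | imp φ ψ ih1 ih2 =>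
    simp only [Formula.Holds, ih1, ih2, Ultrafilter.eventually_imp]
  | all x φ ih =>
    have hupd : ∀ t : HTerm L.skolem C x.1,
        φ.Holds H (Function.update (fun y => q _ (ν y)) x (q _ t)) ↔ ∀ᶠ i in U,
          φ.Holds (B i).struct (Function.update (fun y => skolemValue B e i (ν y)) x
            (skolemValue B e i t)) := fun t => by
      have := ih (Function.update ν x t)
      have h1 : (fun y => q y.1 (Function.update ν x t y)) =
          Function.update (fun y => q _ (ν y)) x (q _ t) :=
        funext fun y => Function.apply_update (fun y : Var L => q y.1) ν x t y
      have h2 : ∀ i, (fun y => skolemValue B e i (Function.update ν x t y)) =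
          Function.update (fun y => skolemValue B e i (ν y)) x (skolemValue B e i t) :=
        fun i => funext fun y =>
          Function.apply_update (fun y : Var L => skolemValue B e i (σ := y.1)) ν x t y
      simpa only [h1, h2] using this
    constructor
    · intro h
      -- With the free variables of `∀ x, φ` as arguments, the term `s` denotes a counterexample in
      -- every `B i` that has one.
      set l : List (Var L) := (φ.finite_freeVars.sdiff (t := {x})).toFinset.toList with hl
      let s : HTerm L.skolem C x.1 :=
        .app (L := L.skolem) (.inr (.inl (φ, x, l))) fun i => ν (l.get i)
      refine ((hupd s).1 (h _)).mono fun i hi => ?_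
      refine Struct.holds_all_of_witness _ _ _ _ ?_
      have : skolemValue B e i s =
          (B i).struct.witness φ x fun y => skolemValue B e i (ν y) := by
        refine Struct.witness_congr _ _ _ fun y hy => ?_
        exact Struct.override_eq _ _ (fun y => skolemValue B e i (ν y)) l (by simpa [hl] using hy)
      rwa [← this]
    · intro h a
      obtain ⟨t, rfl⟩ := hq _ a
      exact (hupd t).2 (h.mono fun i hi => hi _)

variable (U B e)

/-- The Skolem terms modulo an ultrafilter form an interpretation that satisfies a formula if and
only if almost all of the given interpretations do. -/
theorem exists_skolem_hull (hC : ∀ σ : L.Sorts, Small.{w} (HTerm L.skolem C σ))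
    (hne : ∀ σ, Nonempty (C σ)) :
    ∃ (H : Interp.{u, w} L) (q : (σ : L.Sorts) → HTerm L.skolem C σ → H.struct.carrier σ),
      (∀ σ, Function.Surjective (q σ)) ∧
      (∀ σ t t', q σ t = q σ t' ↔
        ∀ᶠ i in U, skolemValue B e i t = skolemValue B e i t') ∧
      ∀ φ : Formula L, H.Sat φ ↔ ∀ᶠ i in U, (B i).Sat φ := by
  let r : (σ : L.Sorts) → Setoid (HTerm L.skolem C σ) := fun σ =>
    { r := fun t t' => ∀ᶠ i in U, skolemValue B e i t = skolemValue B e i t'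
      iseqv :=
        { refl := fun t => .of_forall fun i => rfl
          symm := fun h => h.mono fun i hi => hi.symm
          trans := fun h h' => (h.and h').mono fun i hi => hi.1.trans hi.2 } }
  have : ∀ σ, Small.{w} (Quotient (r σ)) := fun σ =>
    have := hC σ
    small_of_surjective Quotient.mk_surjective
  let q : (σ : L.Sorts) → HTerm L.skolem C σ → Shrink.{w} (Quotient (r σ)) := fun σ t =>
    equivShrink _ (Quotient.mk _ t)
  have hq : ∀ σ, Function.Surjective (q σ) := fun σ =>
    (equivShrink _).surjective.comp Quotient.mk_surjective
  have heq : ∀ σ t t', q σ t = q σ t' ↔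
      ∀ᶠ i in U, skolemValue B e i t = skolemValue B e i t' := fun σ t t' =>
    (equivShrink _).injective.eq_iff.trans Quotient.eq
  let out : (σ : L.Sorts) → Shrink.{w} (Quotient (r σ)) → HTerm L.skolem C σ := fun σ =>
    Function.surjInv (hq σ)
  have hout : ∀ σ t, ∀ᶠ i in U, skolemValue B e i (out σ (q σ t)) = skolemValue B e i t :=
    fun σ t => (heq σ _ _).1 (Function.surjInv_eq (hq σ) _)
  let H : Struct.{u, w} L :=
    { carrier := fun σ => Shrink.{w} (Quotient (r σ))
      carrier_nonempty := fun σ => ⟨q σ (.const ((hne σ).some))⟩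
      funMap := fun f a => q (L.funCod f) (.app (L := L.skolem) (.inl f) fun i => out _ (a i))
      predMap := fun P a =>
        ∀ᶠ i in U, (B i).struct.predMap P fun j => skolemValue B e i (out _ (a j)) }
  have hfun : ∀ (f : L.Funcs)
      (ts : (i : Fin (L.funArity f)) → HTerm L.skolem C (L.funDom f i)),
      H.funMap f (fun i => q _ (ts i)) = q (L.funCod f) (.app (L := L.skolem) (.inl f) ts) := by
    refine fun f ts => (heq _ _ _).2 ((Filter.eventually_all.2 fun j => hout _ (ts j)).mono
      fun i hi => ?_)
    exact congrArg ((B i).struct.funMap f) (funext hi)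
  have hpred : ∀ (P : L.Preds)
      (ts : (i : Fin (L.predArity P)) → HTerm L.skolem C (L.predDom P i)),
      H.predMap P (fun i => q _ (ts i)) ↔
        ∀ᶠ i in U, (B i).struct.predMap P fun j => skolemValue B e i (ts j) := by
    refine fun P ts => Filter.eventually_congr
      ((Filter.eventually_all.2 fun j => hout _ (ts j)).mono fun i hi => ?_)
    rw [funext hi]
  -- The constant for `x` has the value of `x` in every `B i`, so Łoś's theorem at this assignment
  -- speaks about satisfaction.
  let ν : (x : Var L) → HTerm L.skolem C x.1 := fun x =>
    .app (L := L.skolem) (.inr (.inr x)) fun i => Fin.elim0 i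
  exact ⟨⟨H, fun x => q _ (ν x)⟩, q, hq, heq, fun φ =>
    holds_iff_eventually (H := H) hq heq hfun hpred φ ν⟩

end Hull

end ManySorted

/-! ### Shift-invariant generators in finite models -/

namespace ManySorted

/-- A term together with a change of its generators of the sorts in `big` above the sort of the
term that preserves the order of the generators in the term. -/
structure Shift (L : Signature.{u}) [LinearOrder L.Sorts] (C : L.Sorts → Type v)
    [∀ σ, LinearOrder (C σ)] (big : Set L.Sorts) : Type (max u v) where
  sort : L.Sorts
  term : HTerm L C sort
  fn : (τ : L.Sorts) → C τ → C τ
  strictMonoOn : ∀ τ, StrictMonoOn (fn τ) {c | ⟨τ, c⟩ ∈ term.consts}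
  fn_eq : ∀ τ, ¬ (sort < τ ∧ τ ∈ big) → ∀ c, fn τ c = c

/-- If the domains of the sorts in the finite set `G` have suitable finite sizes, then the
generators of these sorts can be interpreted in such a way that the values of finitely many terms
are invariant under given shifts. -/
theorem exists_sizes {L : Signature.{u}} [LinearOrder L.Sorts] {C : L.Sorts → Type v}
    [∀ σ, LinearOrder (C σ)] {big : Set L.Sorts} (Q : Finset (Shift L C big))
    (D : Finset (Σ σ, C σ)) (hD : ∀ q ∈ Q, q.term.consts ⊆ D) (M : L.Sorts → ℕ)
    (G : Finset L.Sorts) :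
    ∃ N : L.Sorts → ℕ, (∀ σ, M σ ≤ N σ) ∧ ∀ A : Struct.{u, w} L,
      (∀ τ ∈ G, Cardinal.mk (A.carrier τ) = N τ) → ∀ e₀ : (σ : L.Sorts) → C σ → A.carrier σ,
      ∃ e : (σ : L.Sorts) → C σ → A.carrier σ, (∀ τ ∉ G, e τ = e₀ τ) ∧
        (∀ τ ∈ G, Set.InjOn (e τ) {c | ⟨τ, c⟩ ∈ D}) ∧
        ∀ q ∈ Q, q.sort ∈ G →
          q.term.eval A e = q.term.eval A fun τ c => e τ (if τ ∈ G then q.fn τ c else c) := by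
  classical
  -- The highest sort is added last, so its size may depend on those of the lower sorts.
  induction G using Finset.induction_on_max with
  | empty => exact ⟨M, fun _ => le_rfl, fun A _ e₀ => ⟨e₀, by simp⟩⟩
  | insert τ G hτ ih =>
    have hτG : τ ∉ G := fun h => lt_irrefl _ (hτ τ h)
    obtain ⟨N₀, hMN, hN₀⟩ := ih
    have hfs : ∀ q : Shift L C big, {c : C τ | ⟨τ, c⟩ ∈ q.term.consts}.Finite := fun q =>
      q.term.finite_consts.preimage (sigma_mk_injective.injOn)
    have hfD : {c : C τ | ⟨τ, c⟩ ∈ D}.Finite :=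
      D.finite_toSet.preimage (sigma_mk_injective.injOn)
    let E : Finset (Σ σ, C σ) := D.filter fun p => p.1 ∈ G
    -- Bounds the number of colours: a colour is a function from the interpretations of the lower
    -- generators in `E` to the domain of `q.sort`.
    let r : ℕ := ∑ q ∈ Q, N₀ q.sort ^ ∏ p : E, N₀ p.1.1
    obtain ⟨N₁, hN₁⟩ := exists_shift_invariant.{max u v, w, v, max u v w}
      (Q.filter fun q => q.sort ∈ G) (fun q => (hfs q).toFinset) (fun q => q.fn τ)
      (fun q _ => by simpa using q.strictMonoOn τ) hfD.toFinset r
    refine ⟨Function.update N₀ τ (max (M τ) N₁), fun σ => ?_, fun A hA e₀ => ?_⟩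
    · by_cases h : σ = τ
      · subst h; simp
      · rw [Function.update_of_ne h]; exact hMN σ
    have hAG : ∀ σ ∈ G, Cardinal.mk (A.carrier σ) = N₀ σ := fun σ hσ => by
      rw [hA σ (Finset.mem_insert_of_mem hσ), Function.update_of_ne (hτ σ hσ).ne]
    have hAτ := hA τ (Finset.mem_insert_self _ _)
    rw [Function.update_self] at hAτ
    have hfin : ∀ σ ∈ G, Finite (A.carrier σ) := fun σ hσ => by
      rw [← Cardinal.lt_aleph0_iff_finite, hAG σ hσ]; exact Cardinal.natCast_lt_aleph0
    have hfinτ : Finite (A.carrier τ) := by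
      rw [← Cardinal.lt_aleph0_iff_finite, hAτ]; exact Cardinal.natCast_lt_aleph0
    have hE : ∀ p : E, Finite (A.carrier p.1.1) := fun p =>
      hfin _ (Finset.mem_filter.1 p.2).2
    let K : Shift L C big → Type (max u v w) := fun q =>
      ((p : E) → A.carrier p.1.1) → ULift.{max u v} (A.carrier q.sort)
    let ext : ((p : E) → A.carrier p.1.1) → (C τ → A.carrier τ) → (σ : L.Sorts) → C σ →
        A.carrier σ := fun x a σ c =>
      if h : ⟨σ, c⟩ ∈ E then x ⟨⟨σ, c⟩, h⟩ else Function.update e₀ τ a σ c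
    let f : ∀ q, (C τ → A.carrier τ) → K q := fun q a x => ⟨q.term.eval A (ext x a)⟩
    have hK : ∀ q ∈ Q.filter fun q => q.sort ∈ G, Finite (K q) ∧ Nat.card (K q) ≤ r := by
      intro q hq
      obtain ⟨hq, hqG⟩ := Finset.mem_filter.1 hq
      have := hfin _ hqG
      refine ⟨inferInstance, ?_⟩
      have hcard : Nat.card (K q) = N₀ q.sort ^ ∏ p : E, N₀ p.1.1 := by
        rw [Nat.card_fun, Nat.card_pi, Nat.card_ulift]
        congr 1
        · rw [Nat.card, hAG _ hqG, Cardinal.toNat_natCast]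
        · refine Finset.prod_congr rfl fun p _ => ?_
          rw [Nat.card, hAG _ (Finset.mem_filter.1 p.2).2, Cardinal.toNat_natCast]
      rw [hcard]
      exact Finset.single_le_sum (f := fun q : Shift L C big => N₀ q.sort ^ ∏ p : E, N₀ p.1.1)
        (fun _ _ => Nat.zero_le _) hq
    -- The generators of sort `τ` are placed first, uniformly in all interpretations of the lower
    -- ones, which are fixed only afterwards.
    obtain ⟨a, ha, haf⟩ := hN₁ (X := A.carrier τ)
      (by rw [Nat.card, hAτ, Cardinal.toNat_natCast]; exact le_max_right _ _) hK f (by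
        intro q _ a a' haa'
        funext x
        refine congrArg ULift.up (q.term.eval_congr A ?_)
        rintro ⟨σ, c⟩ hp
        by_cases h : (⟨σ, c⟩ : Σ σ, C σ) ∈ E
        · simp only [ext, dif_pos h]
        · simp only [ext, dif_neg h]
          by_cases hσ : σ = τ
          · subst hσ
            simpa using haa' c (by simpa using hp)
          · simp only [Function.update_of_ne hσ])
    obtain ⟨e, he₀, hinj, he⟩ := hN₀ A hAG (Function.update e₀ τ a)
    have heτ : e τ = a := by rw [he₀ τ hτG, Function.update_self]
    refine ⟨e, fun σ hσ => ?_, fun σ hσ => ?_, fun q hq hqG => ?_⟩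
    · rw [Finset.mem_insert, not_or] at hσ
      rw [he₀ σ hσ.2, Function.update_of_ne hσ.1]
    · rcases Finset.mem_insert.1 hσ with rfl | hσ
      · rw [heτ]; simpa using ha
      · exact hinj σ hσ
    · by_cases hqG' : q.sort ∈ G
      · rw [he q hq hqG']
        have key := haf q (Finset.mem_filter.2 ⟨hq, hqG'⟩)
        -- The induction hypothesis has shifted the lower generators; the colour at these shifted
        -- values allows the shift in sort `τ` too.
        let x : (p : E) → A.carrier p.1.1 := fun p => e p.1.1 (q.fn p.1.1 p.1.2)
        have key := (ULift.up_injective (congrFun key x)).symm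
        refine (q.term.eval_congr A ?_).trans (key.trans (q.term.eval_congr A ?_))
        all_goals
          rintro ⟨σ, c⟩ hp
          by_cases hσ : σ ∈ G
          · have h : (⟨σ, c⟩ : Σ σ, C σ) ∈ E := Finset.mem_filter.2 ⟨hD q hq hp, hσ⟩
            simp [ext, h, x, hσ]
          · have h : (⟨σ, c⟩ : Σ σ, C σ) ∉ E := fun h => hσ (Finset.mem_filter.1 h).2
            by_cases hστ : σ = τ
            · subst hστ
              simp [ext, h, hσ, heτ]
            · simp [ext, h, hσ, hστ, he₀ σ hσ]
      -- No sort of `insert τ G` lies above `τ`, so nothing moves.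
      · have hqτ : q.sort = τ := (Finset.mem_insert.1 hqG).resolve_right hqG'
        refine q.term.eval_congr A fun p _ => ?_
        split_ifs with hp
        · rw [q.fn_eq]
          rintro ⟨hlt, -⟩
          rw [hqτ] at hlt
          rcases Finset.mem_insert.1 hp with h | h
          · exact hlt.ne' h
          · exact lt_asymm hlt (hτ _ h)
        · rfl

section Core

variable {L : Signature.{u}} [LinearOrder L.skolem.Sorts] {C : L.skolem.Sorts → Type w}
  [∀ σ, LinearOrder (C σ)] {S : Set L.Sorts}

/-- A stably finite and finitely smooth theory has interpretations in which the generators of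
infinite families are interpreted by finitely many elements, subject to finitely many conditions
on distinctness and on invariance under shifts. -/
theorem exists_shift_invariant_interp {T : Theory L} (hfin : Theory.StablyFinite.{u, w} T S)
    (hsmooth : Theory.FinitelySmooth.{u, w} T S) {φ : Formula L} (hφ : φ.IsQF)
    {A : Interp.{u, w} L} (hA : T.IsInterp A) (hAφ : A.Sat φ)
    (hC : ∀ σ ∈ S, A.card σ ≤ Cardinal.mk (C σ))
    (Q : Finset (Shift L.skolem C {σ | σ ∈ S ∧ Infinite (C σ)})) (D : Finset (Σ σ, C σ)) :
    ∃ (B : Interp.{u, w} L) (e : (σ : L.Sorts) → C σ → B.struct.carrier σ),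
      T.IsInterp B ∧ B.Sat φ ∧ (∀ σ ∈ S, Finite (C σ) → Function.Bijective (e σ)) ∧
      (∀ σ ∈ S, Infinite (C σ) → Set.InjOn (e σ) {c | ⟨σ, c⟩ ∈ D}) ∧
      ∀ q ∈ Q, q.sort ∈ S → Infinite (C q.sort) →
        q.term.eval B.skolem e = q.term.eval B.skolem fun τ c => e τ (q.fn τ c) := by
  classical
  obtain ⟨A₀, hA₀, hA₀φ, hA₀S⟩ := hfin φ hφ A hA hAφ
  let E : Finset (Σ σ : L.skolem.Sorts, C σ) := D ∪ Q.biUnion fun q => q.term.finite_consts.toFinset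
  have hE : ∀ q ∈ Q, q.term.consts ⊆ (E : Set (Σ σ : L.skolem.Sorts, C σ)) := fun q hq p hp =>
    Finset.mem_coe.2 (Finset.mem_union_right _
      (Finset.mem_biUnion.2 ⟨q, hq, q.term.finite_consts.mem_toFinset.2 hp⟩))
  let G : Finset L.skolem.Sorts :=
    (E.image Sigma.fst ∪ Q.image Shift.sort).filter fun σ => σ ∈ S ∧ Infinite (C σ)
  obtain ⟨N, hMN, hN⟩ := exists_sizes.{u, w, w} Q E hE (fun σ => (A₀.card σ).toNat) G
  have hle : ∀ σ ∈ S, A₀.card σ ≤ N σ := fun σ hσ => by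
    rw [← Cardinal.cast_toNat_of_lt_aleph0 (hA₀S σ hσ).2]
    exact_mod_cast hMN σ
  -- All sorts of `S` are finite in `A₀`, so finite smoothness controls every one of them.
  obtain ⟨B, hB, hBφ, hBκ⟩ := hsmooth φ hφ A₀ hA₀ hA₀φ
    (fun σ => if Infinite (C σ.1) then (N σ.1 : Cardinal) else Cardinal.mk (C σ.1)) (by
      rintro ⟨σ, hσ, hσS⟩
      dsimp only
      split_ifs with h
      · exact ⟨hle σ hσS, Cardinal.natCast_lt_aleph0⟩
      · rw [not_infinite_iff_finite] at h
        exact ⟨(hA₀S σ hσS).1.trans (hC σ hσS), Cardinal.lt_aleph0_iff_finite.2 h⟩)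
  have hBκ : ∀ σ ∈ S, B.card σ =
      if Infinite (C σ) then (N σ : Cardinal) else Cardinal.mk (C σ) :=
    fun σ hσ => hBκ ⟨σ, (hA₀S σ hσ).2, hσ⟩
  have hex : ∀ σ, ∃ e : C σ → B.struct.carrier σ,
      σ ∈ S → Finite (C σ) → Function.Bijective e := fun σ => by
    by_cases h : σ ∈ S ∧ Finite (C σ)
    · have := hBκ σ h.1
      rw [if_neg (not_infinite_iff_finite.2 h.2)] at this
      obtain ⟨f⟩ := Cardinal.eq.1 this
      exact ⟨f.symm, fun _ _ => f.symm.bijective⟩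
    · exact ⟨fun _ => (B.struct.carrier_nonempty σ).some, fun h1 h2 => absurd ⟨h1, h2⟩ h⟩
  choose e₀ he₀ using hex
  obtain ⟨e, hee₀, hinj, he⟩ := hN B.skolem (fun σ hσ => by
    have hσ := (Finset.mem_filter.1 hσ).2
    exact (hBκ σ hσ.1).trans (if_pos hσ.2)) e₀
  refine ⟨B, e, hB, hBφ, fun σ hσ hfin => ?_, fun σ hσ hσi => ?_, fun q hq hqS hqi => ?_⟩
  · rw [hee₀ σ fun h => not_infinite_iff_finite.2 hfin (Finset.mem_filter.1 h).2.2]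
    exact he₀ σ hσ hfin
  · intro c hc d hd hcd
    refine hinj σ (Finset.mem_filter.2 ⟨Finset.mem_union_left _ ?_, hσ, hσi⟩)
      (Finset.mem_union_left _ hc) (Finset.mem_union_left _ hd) hcd
    exact Finset.mem_image.2 ⟨_, Finset.mem_union_left _ hc, rfl⟩
  · rw [he q hq (Finset.mem_filter.2
      ⟨Finset.mem_union_right _ (Finset.mem_image_of_mem _ hq), hqS, hqi⟩)]
    refine q.term.eval_congr _ fun p hp => ?_
    split_ifs with h
    · rfl
    · rw [q.fn_eq]
      exact fun hp' => h (Finset.mem_filter.2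
        ⟨Finset.mem_union_left _ (Finset.mem_image_of_mem _ (hE q hq hp)), hp'.2⟩)

end Core

end ManySorted

/-! ### Cardinalities of the hull and conclusion -/

namespace ManySorted

/-- Allows the hull to live in the universe of the given interpretations. -/
theorem HTerm.small {L : Signature.{u}} [Countable L.Funcs] [Countable L.Sorts]
    (C : L.Sorts → Type w) (σ : L.Sorts) : Small.{w} (HTerm L C σ) := by
  have h : Cardinal.mk (HTerm L C σ) ≤ Cardinal.mk ((Σ σ, C σ) ⊕ ULift.{w} ℕ) := by
    refine (HTerm.mk_le L C σ).trans (max_le ?_ ?_)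
    · simp
    · simp
  obtain ⟨f⟩ := h
  have : Small.{w} L.Sorts := Countable.toSmall _
  exact small_of_injective f.injective

/-- The order of the elements of a finite set, transferred to the values of an increasing
sequence. -/
theorem strictMonoOn_card_filter_lt {α β : Type*} [LinearOrder α] [Preorder β] (s : Finset α)
    {ι : ℕ → β} (hι : StrictMono ι) :
    StrictMonoOn (fun c => ι (s.filter (· < c)).card) (s : Set α) := by
  intro c hc d _ hcd
  refine hι (Finset.card_lt_card (Finset.ssubset_iff_subset_ne.2 ⟨fun x hx => ?_, fun h => ?_⟩))
  · rw [Finset.mem_filter] at hx ⊢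
    exact ⟨hx.1, hx.2.trans hcd⟩
  · have : c ∈ s.filter (· < d) := Finset.mem_filter.2 ⟨hc, hcd⟩
    rw [← h, Finset.mem_filter] at this
    exact lt_irrefl _ this.2

theorem HTerm.map_map {L : Signature.{u}} {C : L.Sorts → Type w} {D : L.Sorts → Type v}
    {E : L.Sorts → Type z} (g : (σ : L.Sorts) → C σ → D σ) (h : (σ : L.Sorts) → D σ → E σ)
    {σ : L.Sorts} (t : HTerm L C σ) : (t.map g).map h = t.map fun σ c => h σ (g σ c) := by
  induction t with
  | const c => rfl
  | app f ts ih => exact congrArg (HTerm.app f) (funext ih)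

/-- A quotient of the terms of sort `σ` that is invariant under shifts is not larger than the set
of generators of sort `σ`, provided that lower sorts do not have more generators. -/
theorem mk_le_of_shift_invariant {L : Signature.{u}} [Countable L.Funcs] [Countable L.Sorts]
    [LinearOrder L.Sorts] {C : L.Sorts → Type w} [∀ σ, LinearOrder (C σ)]
    [∀ σ, Nonempty (C σ)] {big : Set L.Sorts} {σ : L.Sorts} [Infinite (C σ)]
    (hω : ∀ τ ∈ big, ∃ ι : ℕ → C τ, StrictMono ι)
    (hle : ∀ τ, ¬ (σ < τ ∧ τ ∈ big) → Cardinal.mk (C τ) ≤ Cardinal.mk (C σ))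
    {H : Type w} {q : HTerm L C σ → H} (hq : Function.Surjective q)
    (hinv : ∀ s : Shift L C big, ∀ h : s.sort = σ,
      q (h ▸ s.term) = q (h ▸ s.term.map s.fn)) :
    Cardinal.mk H ≤ Cardinal.mk (C σ) := by
  classical
  choose! ι hι using hω
  let P : (τ : L.Sorts) → C τ → Prop := fun τ c => σ < τ ∧ τ ∈ big → c ∈ Set.range (ι τ)
  have hsurj : Function.Surjective fun t : HTerm L (fun τ => {c : C τ // P τ c}) σ =>
      q (t.map fun _ c => c.1) := by
    intro a
    obtain ⟨t, rfl⟩ := hq a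
    have hfs : ∀ τ, {c : C τ | ⟨τ, c⟩ ∈ t.consts}.Finite := fun τ =>
      t.finite_consts.preimage (sigma_mk_injective.injOn)
    -- A generator of a higher big sort goes to the entry of the sequence at its rank among the
    -- generators in `t`.
    let g : (τ : L.Sorts) → C τ → {c : C τ // P τ c} := fun τ c =>
      if h : σ < τ ∧ τ ∈ big then ⟨ι τ ((hfs τ).toFinset.filter (· < c)).card, fun _ => ⟨_, rfl⟩⟩
      else ⟨c, fun h' => absurd h' h⟩
    have hg1 : ∀ τ, σ < τ ∧ τ ∈ big → ∀ c,
        (g τ c).1 = ι τ ((hfs τ).toFinset.filter (· < c)).card := fun τ h c => by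
      simp only [g, dif_pos h]
    have hg2 : ∀ τ, ¬ (σ < τ ∧ τ ∈ big) → ∀ c, (g τ c).1 = c := fun τ h c => by
      simp only [g, dif_neg h]
    let s : Shift L C big :=
      { sort := σ
        term := t
        fn := fun τ c => (g τ c).1
        strictMonoOn := fun τ => by
          by_cases h : σ < τ ∧ τ ∈ big
          · simp only [hg1 τ h]
            have := strictMonoOn_card_filter_lt (hfs τ).toFinset (hι τ h.2)
            rwa [Set.Finite.coe_toFinset] at this
          · simp only [hg2 τ h]
            exact strictMonoOn_id
        fn_eq := hg2 }
    refine ⟨t.map g, ?_⟩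
    dsimp only
    rw [HTerm.map_map]
    exact (hinv s rfl).symm
  have h1 := Cardinal.lift_mk_le_lift_mk_of_surjective hsurj
  have h2 := HTerm.mk_le L (fun τ => {c : C τ // P τ c}) σ
  have hemb : ∀ τ, Nonempty ({c : C τ // P τ c} ↪ C σ) := fun τ => by
    rw [← Cardinal.le_def]
    by_cases h : σ < τ ∧ τ ∈ big
    · have : Countable {c : C τ // P τ c} := by
        have : Countable {c : C τ // c ∈ Set.range (ι τ)} :=
          (Set.countable_range (ι τ)).to_subtype
        exact Function.Injective.countable (f := fun c : {c : C τ // P τ c} =>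
          (⟨c.1, c.2 h⟩ : {c : C τ // c ∈ Set.range (ι τ)})) fun c d hcd => by
            simpa [Subtype.ext_iff] using hcd
      exact (Cardinal.mk_le_aleph0_iff.2 this).trans (Cardinal.aleph0_le_mk _)
    · exact (Cardinal.mk_subtype_le _).trans (hle τ h)
  have h3 : Cardinal.mk (Σ τ, {c : C τ // P τ c}) ≤ Cardinal.mk (L.Sorts × C σ) :=
    Cardinal.mk_le_of_injective (f := fun p => (p.1, (hemb p.1).some p.2)) (by
      rintro ⟨τ, c⟩ ⟨τ', c'⟩ h
      obtain ⟨h1, h2⟩ := Prod.mk.inj h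
      cases h1
      exact congrArg _ ((hemb τ).some.injective h2))
  have h4 : Cardinal.mk (L.Sorts × C σ) ≤ Cardinal.lift.{u} (Cardinal.mk (C σ)) := by
    rw [Cardinal.mk_prod]
    refine Cardinal.mul_le_of_le ?_ ?_ ?_
    · simp
    · refine le_trans ?_ (Cardinal.aleph0_le_lift.2 (Cardinal.aleph0_le_mk (C σ)))
      simp
    · exact le_rfl
  have h5 := h2.trans (max_le (h3.trans h4)
    (Cardinal.aleph0_le_lift.2 (Cardinal.aleph0_le_mk (C σ))))
  have h6 := h1.trans (Cardinal.lift_le.2 h5)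
  simpa using h6

section

variable {L : Signature.{u}} [LinearOrder L.skolem.Sorts] {C : L.skolem.Sorts → Type w}
  [∀ σ, LinearOrder (C σ)] [hne : ∀ σ, Nonempty (C σ)] {S : Set L.Sorts}

/-- The cardinalities of the domains of the sorts in `S` can be prescribed, here by a family of
linearly ordered sets indexed by a linear order of the sorts that refines the cardinalities. -/
theorem exists_interp_card_eq (hL : L.IsCountable) {T : Theory L}
    (hfin : Theory.StablyFinite.{u, w} T S) (hsmooth : Theory.FinitelySmooth.{u, w} T S)
    {φ : Formula L} (hφ : φ.IsQF) {A : Interp.{u, w} L} (hA : T.IsInterp A) (hAφ : A.Sat φ)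
    (hC : ∀ σ ∈ S, A.card σ ≤ Cardinal.mk (C σ))
    (hω : ∀ σ : L.skolem.Sorts, σ ∈ S → Infinite (C σ) → ∃ ι : ℕ → C σ, StrictMono ι)
    (hcount : ∀ σ : L.skolem.Sorts, σ ∉ S → Countable (C σ))
    (hmono : ∀ σ τ, σ ≤ τ → Cardinal.mk (C σ) ≤ Cardinal.mk (C τ)) :
    ∃ B : Interp.{u, w} L, T.IsInterp B ∧ B.Sat φ ∧ ∀ σ ∈ S, B.card σ = Cardinal.mk (C σ) := by
  classical
  have hS : Countable L.skolem.Sorts := hL.1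
  have hF : Countable L.skolem.Funcs := Signature.countable_skolem_funcs hL
  -- An index is a finite set of demands, for invariance and for distinctness; each demand is met
  -- eventually along `atTop`.
  let I := Finset (Shift L.skolem C {σ | σ ∈ S ∧ Infinite (C σ)}) × Finset (Σ σ, C σ)
  choose B e hB hBφ hbij hinj hinv using fun i : I =>
    exists_shift_invariant_interp hfin hsmooth hφ hA hAφ hC i.1 i.2
  let U : Ultrafilter I := Ultrafilter.of Filter.atTop
  have hU : ∀ i₀ : I, ∀ᶠ i in U, i₀ ≤ i := fun i₀ =>
    Ultrafilter.of_le _ (Filter.eventually_ge_atTop i₀)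
  obtain ⟨H, q, hq, heq, hH⟩ := exists_skolem_hull U B e (fun σ => HTerm.small C σ) hne
  refine ⟨H, fun ψ hψ => (hH _).2 (.of_forall fun i => hB i ψ hψ),
    (hH _).2 (.of_forall fun i => hBφ i), fun σ hσ => ?_⟩
  rcases finite_or_infinite (C σ) with hfinσ | hinfσ
  · refine (Cardinal.mk_congr (Equiv.ofBijective (fun c : C σ => q σ (.const c))
      ⟨fun c d hcd => ?_, fun a => ?_⟩)).symm
    · obtain ⟨i, hi⟩ := ((heq σ _ _).1 hcd).exists
      exact (hbij i σ hσ hfinσ).1 hi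
    · obtain ⟨t, rfl⟩ := hq σ a
      -- As `C σ` is finite, the ultrafilter selects a single generator.
      have : ∀ᶠ i in U, ∃ c : C σ, e i σ c = skolemValue B e i t :=
        .of_forall fun i => (hbij i σ hσ hfinσ).2 _
      obtain ⟨c, hc⟩ := Ultrafilter.eventually_exists_iff.1 this
      exact ⟨c, (heq σ _ _).2 hc⟩
  · refine le_antisymm ?_ ?_
    · refine mk_le_of_shift_invariant (L := L.skolem)
        (big := {σ | σ ∈ S ∧ Infinite (C σ)}) (σ := σ) (fun τ hτ => hω τ hτ.1 hτ.2) ?_ (hq σ) ?_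
      · intro τ hτ
        by_cases hle : τ ≤ σ
        · exact hmono _ _ hle
        -- A higher sort that is not shifted is finite or lies outside `S`, hence has countably many
        -- generators.
        · refine le_trans ?_ (Cardinal.aleph0_le_mk (C σ))
          by_cases hτS : τ ∈ S
          · have : ¬ Infinite (C τ) := fun h => hτ ⟨not_le.1 hle, hτS, h⟩
            rw [not_infinite_iff_finite] at this
            exact (Cardinal.lt_aleph0_iff_finite.2 this).le
          · exact Cardinal.mk_le_aleph0_iff.2 (hcount τ hτS)
      · rintro s rfl
        refine (heq _ _ _).2 ((hU ({s}, ∅)).mono fun i hi => ?_)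
        refine (hinv i s (hi.1 (Finset.mem_singleton_self s)) hσ hinfσ).trans ?_
        exact (HTerm.eval_map _ _ _ _).symm
    · refine Cardinal.mk_le_of_injective (f := fun c : C σ => q σ (.const c)) fun c d hcd => ?_
      obtain ⟨i, hi, hi'⟩ := (((heq σ _ _).1 hcd).and (hU (∅, {⟨σ, c⟩, ⟨σ, d⟩}))).exists
      exact hinj i σ hσ hinfσ (hi'.2 (by simp)) (hi'.2 (by simp)) hi

end

end ManySorted

theorem mainTheorem2 (L : ManySorted.Signature.{u}) (hL : L.IsCountable)
    (T : ManySorted.Theory L) (S : Set L.Sorts)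
    (hfin : ManySorted.Theory.StablyFinite.{u, w} T S)
    (hsmooth : ManySorted.Theory.FinitelySmooth.{u, w} T S) :
    ManySorted.Theory.Smooth.{u, w} T S := by
  classical
  intro φ hφ A hA hAφ κ hκ
  let k : L.skolem.Sorts → Cardinal.{w} := fun σ =>
    if h : σ ∈ S then κ ⟨σ, h⟩ else Cardinal.aleph0
  have hk : ∀ σ (h : σ ∈ S), k σ = κ ⟨σ, h⟩ := fun σ h => dif_pos h
  have hk0 : ∀ σ, k σ ≠ 0 := fun σ => by
    by_cases h : σ ∈ S
    · have := A.struct.carrier_nonempty σ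
      rw [hk σ h]
      exact (lt_of_lt_of_le (pos_iff_ne_zero.2 (Cardinal.mk_ne_zero _)) (hκ ⟨σ, h⟩)).ne'
    · simp only [k, dif_neg h]
      exact Cardinal.aleph0_ne_zero
  let C : L.skolem.Sorts → Type w := fun σ => (k σ).ord.ToType
  have hCk : ∀ σ, Cardinal.mk (C σ) = k σ := fun σ => Cardinal.mk_ord_toType _
  have hne : ∀ σ, Nonempty (C σ) := fun σ =>
    Cardinal.mk_ne_zero_iff.1 (by rw [hCk]; exact hk0 σ)
  have : Countable L.skolem.Sorts := hL.1
  obtain ⟨code, hcode⟩ := exists_injective_nat L.skolem.Sorts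
  -- Sorts are compared by cardinality first; the injective code breaks ties.
  let key : L.skolem.Sorts → Cardinal.{w} ×ₗ ℕ := fun σ => toLex (k σ, code σ)
  let _ : LinearOrder L.skolem.Sorts := LinearOrder.lift' key fun σ τ h =>
    hcode (Prod.mk.inj (toLex.injective h)).2
  obtain ⟨B, hB, hBφ, hBC⟩ := ManySorted.exists_interp_card_eq (C := C) hL hfin hsmooth hφ hA hAφ
    (fun σ h => (hκ ⟨σ, h⟩).trans ((hCk σ).trans (hk σ h)).ge)
    (fun σ _ hinf => by
      have := hne σ
      -- An infinite initial ordinal has no maximum, which gives the increasing sequence.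
      have := Cardinal.noMaxOrder (c := k σ) (by rw [← hCk]; exact Cardinal.aleph0_le_mk _)
      exact Nat.exists_strictMono _)
    (fun σ h => by
      rw [← Cardinal.mk_le_aleph0_iff, hCk]
      simp only [k, dif_neg h]
      exact le_rfl)
    (fun σ τ h => by
      rw [hCk, hCk]
      exact Prod.Lex.monotone_fst (key σ) (key τ) h)
  exact ⟨B, hB, hBφ, fun σ => (hBC σ.1 σ.2).trans ((hCk σ.1).trans (hk σ.1 σ.2))⟩
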